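/- **Setting.** Let $\mathcal G$ be a weighted digraph on agents $1,\dots,n$ with weights $a_{ij}\ge 0$, $a_{ii}=0$, where $a_{ij}>0$ iff there is a link from $j$ to $i$, and let $L=\mathrm{diag}\big(\sum_j a_{1j},\dots,\sum_j a_{nj}\big)-(a_{ij})$ be its Laplacian. Suppose $\mathcal G$ has a directed spanning tree (some agent has a directed path to every other agent) and the agents are numbered such that $L$ is block upper triangular with diagonal blocks $L^{1,1},\dots,L^{M,M}$ that correspond to the strongly connected components of $\mathcal G$. Let $\tilde L^{M,M}$ be $L^{M,M}$ with its diagonal entries replaced so that all row sums are zero, let $\xi^M$ be the positive left eigenvector of $\tilde L^{M,M}$ for the eigenvalue $0$ with entries of sum $1$, and let $\nu(t)=\sum_{i}\xi^M_i x^M_i(t)\in\mathbb R^p$ be the weighted average of the states of the agents in the last (root) component. Let $h>0$ and $g(s)=(g_1(s_1),\dots,g_p(s_p))$ for $s\in\mathbb R^p$, where each $g_l:\mathbb R\to\mathbb R$ is (1) continuous, (2) nondecreasing, and strictly increasing on $[-h,h]$, (3) zero exactly at $0$, (4) Lipschitz on every compact set, and (5) such that for some $\varrho>0$, $|g_l(x)-g_l(y)|\ge\varrho|x-y|$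 for all $x,y\in[-h,h]$. Given $\alpha_i,\beta_i>0$, consider the states $x_i(t)\in\mathbb R^p$ with $$\dot x_i(t)=-\sum_{j=1}^n L_{ij}\,g(\hat x_j(t)),\qquad \hat x_j(t)=x_j\big(t^j_{k_j(t)}\big),\quad k_j(t)=\max\{k: t^j_k\le t\},$$ where the triggering times are $t^i_1=0$ and $$t^i_{k+1}=\max\big\{r\ge t^i_k:\ \|g(x_i(t^i_k))-g(x_i(t))\|^2\le\alpha_i e^{-\beta_i t}\ \ \forall t\in[t^i_k,r]\big\};$$ if there is no maximum because the bound holds for all $t\ge t_k^i$, agent $i$ does not trigger again. (In the maximum, $x_i$ past $t^i_{k+1}$ stands for a continuation of the motion of agent $i$ in which it has not been resampled.) Suppose that $x(0)\ne \mathbf 1_n\otimes\nu(0)$, i.e. $x_i(0)\neq\nu(0)$ for some $i$. **Theorem.** (i) There is no Zeno behaviour: for every $0<T\le\infty$ and every trajectory of the closed-loop system on $[0,T)$, each agent has only finitely many triggering times in each bounded part of $[0,T)$ (so on all of $[0,T)$ if $T<\infty$). (ii) If $|\nu_l(0)|<h$ for all $l=1,\dots,p$, then every trajectory on $[0,\infty)$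 reaches consensus with consensus value $\nu(0)$: $\lim_{t\to\infty}x_i(t)=\nu(0)$ for all $i$. -/

import Mathlib

open Filter Topology Set

noncomputable section

namespace EventTriggered

/-- A weighted directed graph on the agents `0, …, n - 1`. The entry `weight i j` is the weight of
the link from agent `j` to agent `i`; the link is present iff the weight is positive. -/
structure WeightedDigraph (n : ℕ) where
  weight : Matrix (Fin n) (Fin n) ℝ
  weight_nonneg : ∀ i j, 0 ≤ weight i j
  weight_self : ∀ i, weight i i = 0

namespace WeightedDigraph

variable {n : ℕ} (G : WeightedDigraph n)

/-- There is a link from agent `i` to agent `j`. -/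
def Link (i j : Fin n) : Prop := 0 < G.weight j i

/-- There is a directed path (possibly of length zero) from agent `i` to agent `j`. -/
def Reaches (i j : Fin n) : Prop := Relation.ReflTransGen G.Link i j

/-- Some agent has a directed path to every agent. -/
def HasSpanningTree : Prop := ∃ r, ∀ i, G.Reaches r i

/-- The Laplacian: in-degree matrix minus weight matrix. -/
def laplacian : Matrix (Fin n) (Fin n) ℝ :=
  Matrix.diagonal (fun i => ∑ j, G.weight i j) - G.weight

/-- The Laplacian is block upper triangular, the blocks being the strongly connected components:
`c i` is the number of the component of agent `i`, and agents are numbered component by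
component. -/
structure IsPerronFrobeniusForm {M : ℕ} (c : Fin n → Fin (M + 1)) : Prop where
  monotone : Monotone c
  surjective : Function.Surjective c
  component_iff : ∀ i j, c i = c j ↔ G.Reaches i j ∧ G.Reaches j i
  upper : ∀ i j, c j < c i → G.laplacian i j = 0

/-- The diagonal block of the Laplacian that belongs to component `m`. -/
def block {M : ℕ} (c : Fin n → Fin (M + 1)) (m : Fin (M + 1)) :
    Matrix {i // c i = m} {i // c i = m} ℝ :=
  G.laplacian.submatrix (fun i => i.1) (fun i => i.1)

/-- The diagonal block with its diagonal changed so that all row sums vanish. -/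
def blockTilde {M : ℕ} (c : Fin n → Fin (M + 1)) (m : Fin (M + 1)) :
    Matrix {i // c i = m} {i // c i = m} ℝ :=
  fun i j => if i = j then -∑ r ∈ Finset.univ.erase i, G.block c m i r else G.block c m i j

/-- `ξ` is the positive left eigenvector of the modified diagonal block of component `m` for the
eigenvalue zero, normalized to have sum one. -/
structure IsPerronVector {M : ℕ} (c : Fin n → Fin (M + 1)) (m : Fin (M + 1))
    (ξ : {i // c i = m} → ℝ) : Prop where
  pos : ∀ i, 0 < ξ i
  sum_eq_one : ∑ i, ξ i = 1
  left_null : Matrix.vecMul ξ (G.blockTilde c m) = 0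

end WeightedDigraph

/-- The assumptions on a scalar output function `f`, with the constant `h`. -/
structure OutputAssumption (f : ℝ → ℝ) (h : ℝ) : Prop where
  continuous : Continuous f
  monotone : Monotone f
  h_pos : 0 < h
  strictMonoOn : StrictMonoOn f (Icc (-h) h)
  eq_zero_iff : ∀ x, f x = 0 ↔ x = 0
  lipschitz : ∀ S : Set ℝ, IsCompact S → ∃ K > 0, ∀ x ∈ S, ∀ y ∈ S, |f x - f y| ≤ K * |x - y|
  lower : ∃ ϱ > 0, ∀ x ∈ Icc (-h) h, ∀ y ∈ Icc (-h) h, ϱ * |x - y| ≤ |f x - f y|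

/-- The componentwise output map on `ℝ^p`. -/
def output {p : ℕ} (g : Fin p → ℝ → ℝ) (s : EuclideanSpace ℝ (Fin p)) :
    EuclideanSpace ℝ (Fin p) :=
  WithLp.toLp 2 (fun l => g l (s l))

/-- At time `s`, the motion `z`, last sampled at time `a`, satisfies the error bound
`‖g(z(a)) - g(z(s))‖² ≤ α e^{-β s}`. -/
def ErrorBound {p : ℕ} (g : Fin p → ℝ → ℝ) (α β : ℝ) (z : ℝ → EuclideanSpace ℝ (Fin p))
    (a s : ℝ) : Prop :=
  ‖output g (z a) - output g (z s)‖ ^ 2 ≤ α * Real.exp (-β * s)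

/-- The number of the last triggering time that is `≤ s`; in a trajectory these numbers are bounded
and the supremum is a maximum. -/
def lastIndex (τ : ℕ → EReal) (s : ℝ) : ℕ := sSup {k | τ k ≤ (s : EReal)}

/-- The state of an agent at its last triggering time `≤ s`. -/
def sampled {p : ℕ} (x : ℝ → EuclideanSpace ℝ (Fin p)) (τ : ℕ → EReal) (s : ℝ) :
    EuclideanSpace ℝ (Fin p) :=
  x (τ (lastIndex τ s)).toReal

/-- The event-triggered consensus protocol: the input of agent `i` at time `s`. -/
def input {n p : ℕ} (G : WeightedDigraph n) (g : Fin p → ℝ → ℝ)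
    (x : Fin n → ℝ → EuclideanSpace ℝ (Fin p)) (τ : Fin n → ℕ → EReal) (i : Fin n) (s : ℝ) :
    EuclideanSpace ℝ (Fin p) :=
  -∑ j, G.laplacian i j • output g (sampled (x j) (τ j) s)

/-- `x` and `τ` are the states and the triggering times of the closed-loop system on `[0, T)`, where
`0 < T ≤ ∞`.

The triggering times are numbered from `0`. If agent `i` has only finitely many of them before `T`,
the remaining terms of `τ i` are `≥ T` (hence `⊤` when `T = ⊤`) and are no events of the trajectory.

In `trigger`, the next triggering time `b` is the largest `r` such that the error bound holds on
`[a, r]`. The error in this maximum is the one of an agent that is not resampled at `b`, whereas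
from `b` on the state `x i` moves under the updated input; so the maximum is taken along a
continuous motion `z` that is `x i` up to time `b`. Nothing else is asked of `z`, so that the
trajectories of the law are included however a continuation past `b` is chosen.

Since the input is right-continuous and piecewise constant, the differential equation is expressed
by continuity and right derivatives. Existence of a last triggering time is required at each time
`s < T` only, which leaves open whether triggering times accumulate at `T`. -/
structure IsTrajectory {n p : ℕ} (G : WeightedDigraph n) (g : Fin p → ℝ → ℝ) (α β : Fin n → ℝ)
    (T : EReal) (x : Fin n → ℝ → EuclideanSpace ℝ (Fin p)) (τ : Fin n → ℕ → EReal) : Prop where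
  horizon_pos : 0 < T
  first : ∀ i, τ i 0 = 0
  monotone : ∀ i, Monotone (τ i)
  trigger : ∀ i k (a : ℝ), τ i k = (a : EReal) → (a : EReal) < T →
    (∃ b : ℝ, τ i (k + 1) = (b : EReal) ∧ (b : EReal) < T ∧
      ∃ z : ℝ → EuclideanSpace ℝ (Fin p), Continuous z ∧ EqOn z (x i) (Icc a b) ∧
        IsGreatest {r | a ≤ r ∧ ∀ s ∈ Icc a r, ErrorBound g (α i) (β i) z a s} b) ∨
    (T ≤ τ i (k + 1) ∧
      ∀ s : ℝ, a ≤ s → (s : EReal) < T → ErrorBound g (α i) (β i) (x i) a s)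
  last : ∀ i (s : ℝ), 0 ≤ s → (s : EReal) < T → BddAbove {k | τ i k ≤ (s : EReal)}
  continuousOn : ∀ i, ContinuousOn (x i) {s : ℝ | 0 ≤ s ∧ (s : EReal) < T}
  deriv_right : ∀ i (s : ℝ), 0 ≤ s → (s : EReal) < T →
    HasDerivWithinAt (x i) (input G g x τ i s) (Ici s) s

/-- Every agent triggers only finitely often in every bounded part of `[0, T)`; if `T < ∞`, this
bounds the number of events on all of `[0, T)`. -/
def NoZeno {n : ℕ} (T : EReal) (τ : Fin n → ℕ → EReal) : Prop :=
  ∀ i (b : ℝ), {k | τ i k ≤ (b : EReal) ∧ τ i k < T}.Finite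

/-- The weighted average `ν(s)` of the states in component `m`. -/
def componentAverage {n p M : ℕ} (c : Fin n → Fin (M + 1)) (m : Fin (M + 1))
    (ξ : {i // c i = m} → ℝ) (x : Fin n → ℝ → EuclideanSpace ℝ (Fin p)) (s : ℝ) :
    EuclideanSpace ℝ (Fin p) :=
  ∑ r, ξ r • x r.1 s

end EventTriggered

end

open Filter Topology Set

noncomputable section

namespace EventTriggered

/-! The triggering rule keeps the output error of every agent below a decaying exponential. Each
coordinate is therefore a consensus flow driven by monotone outputs, with a perturbation that is
integrable in time (`IsPerturbedFlow`).

At an agent of maximal state, monotonicity of the output makes the Laplacian term push downwards, so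
the maximum grows at most by a multiple of the integrated error, and dually for the minimum. States
thus stay bounded, and closeness to a constant, once reached at a late time, is nearly preserved
(`abs_sub_le`).

Bounded states have bounded inputs, so outputs are Lipschitz in time. At a triggering time the error
bound is exhausted (`le_norm_sub`), which forces a positive gap between triggerings on every bounded
time interval and excludes Zeno behaviour.

For consensus, the weighted average `θ` of the root component is conserved, so `f (y j) - f θ` has
no strict sign on that component. This makes the Lyapunov function `∑ ζ i * potential f θ (y i)`
decrease at rate at least half of `∑ (f (y i) - f θ) ^ 2`, up to an integrable term, for the weights
of `exists_dissipation_weights`. As it is nonnegative, the sum of squares is small at arbitrarily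
late times. Strict monotonicity of `f` near `θ` turns this into closeness of the states, which then
persists. -/

/-! ### Comparison principle for the maximum of a finite family -/

/-- If the right derivative of a maximal member of a finite family is at most the right derivative
of `B`, then `B` stays an upper bound of the family. -/
theorem le_of_deriv_right_le_at_max {ι : Type*} [Finite ι] {a b : ℝ} {y d : ι → ℝ → ℝ}
    {B κ : ℝ → ℝ} (hy : ∀ i, ContinuousOn (y i) (Icc a b))
    (hd : ∀ i, ∀ t ∈ Ico a b, HasDerivWithinAt (y i) (d i t) (Ici t) t)
    (hB : ContinuousOn B (Icc a b))
    (hB' : ∀ t ∈ Ico a b, HasDerivWithinAt B (κ t) (Ici t) t)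
    (bound : ∀ t ∈ Ico a b, ∀ i, (∀ j, y j t ≤ y i t) → d i t ≤ κ t)
    (h0 : ∀ i, y i a ≤ B a) (i : ι) {t : ℝ} (ht : t ∈ Icc a b) : y i t ≤ B t := by
  -- The slack makes the comparison strict: at a point of contact the difference has right
  -- derivative at most `-δ`. It is removed by `δ → 0`.
  have key : ∀ δ > 0, ∀ t ∈ Icc a b, ∀ i, y i t ≤ B t + δ * (t - a) := by
    intro δ hδ
    have hcl : IsClosed ({t | ∀ i, y i t ≤ B t + δ * (t - a)} ∩ Icc a b) := by
      have : {t | ∀ i, y i t ≤ B t + δ * (t - a)} ∩ Icc a b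
          = Icc a b ∩ ⋂ i, {t ∈ Icc a b | y i t ≤ B t + δ * (t - a)} := by
        ext t
        simp only [mem_inter_iff, mem_ofPred_eq, mem_iInter]
        exact ⟨fun h => ⟨h.2, fun i => ⟨h.2, h.1 i⟩⟩, fun h => ⟨fun i => (h.2 i).2, h.1⟩⟩
      rw [this]
      refine isClosed_Icc.inter (isClosed_iInter fun i => ?_)
      exact isClosed_Icc.isClosed_le (hy i)
        (hB.add (Continuous.continuousOn (by fun_prop)))
    refine hcl.Icc_subset_of_forall_exists_gt (fun i => by simpa using h0 i) ?_
    rintro x ⟨hx, hxI⟩ z hz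
    have hev : ∀ᶠ s in 𝓝[>] x, ∀ i, y i s ≤ B s + δ * (s - a) := by
      rw [eventually_all]
      intro i
      have hD : HasDerivWithinAt (fun s => y i s - (B s + δ * (s - a)))
          (d i x - (κ x + δ)) (Ici x) x := by
        have h1 : HasDerivWithinAt (fun s => δ * (s - a)) δ (Ici x) x := by
          simpa using (((hasDerivAt_id x).sub_const a).const_mul δ).hasDerivWithinAt
        exact (hd i x hxI).sub ((hB' x hxI).add h1)
      rcases lt_or_eq_of_le (hx i) with hlt | heq
      · have hc := hD.continuousWithinAt.tendsto.mono_left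
          (nhdsWithin_mono x Ioi_subset_Ici_self)
        filter_upwards [hc.eventually_lt_const (sub_neg.mpr hlt)] with s hs
        linarith
      -- A member that touches the common upper bound is maximal in the family.
      · have hmax : d i x ≤ κ x := bound x hxI i fun j => heq ▸ hx j
        have hs := hD.limsup_slope_le (r := 0) (by linarith)
        rw [Ici_sdiff_left] at hs
        filter_upwards [hs, self_mem_nhdsWithin] with s hs hsx
        rw [slope_def_field, div_lt_iff₀ (sub_pos.mpr hsx)] at hs
        linarith
    obtain ⟨s, hs1, hs2⟩ := (hev.and (Ioc_mem_nhdsGT hz)).exists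
    exact ⟨s, hs1, hs2⟩
  have hlim : Tendsto (fun δ => B t + δ * (t - a)) (𝓝[>] 0) (𝓝 (B t)) := by
    have : Continuous fun δ => B t + δ * (t - a) := by fun_prop
    simpa using (this.tendsto 0).mono_left nhdsWithin_le_nhds
  exact ge_of_tendsto hlim (eventually_mem_nhdsWithin.mono fun δ hδ => key δ hδ t ht i)

/-! ### The Laplacian and its inverse-nonnegative perturbation -/

namespace WeightedDigraph

variable {n : ℕ} (G : WeightedDigraph n)

theorem sum_laplacian_mul (u : Fin n → ℝ) (i : Fin n) :
    ∑ j, G.laplacian i j * u j = ∑ j, G.weight i j * (u i - u j) := by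
  simp [laplacian, sub_mul, mul_sub, Matrix.diagonal_apply, Finset.sum_mul]

theorem sum_laplacian (i : Fin n) : ∑ j, G.laplacian i j = 0 := by
  simpa using G.sum_laplacian_mul (fun _ => 1) i

theorem laplacian_of_ne {i j : Fin n} (h : i ≠ j) : G.laplacian i j = -G.weight i j := by
  simp [laplacian, h]

variable {G}

/-- Minimum principle: the Laplacian plus the indicator of a set `R` is inverse-nonnegative if
some member of `R` reaches every agent. -/
theorem nonneg_of_laplacian_add_diagonal {R : Fin n → Prop} [DecidablePred R]
    {r : Fin n} (hr : R r) (hreach : ∀ i, G.Reaches r i) {u : Fin n → ℝ}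
    (hu : ∀ i, 0 ≤ ∑ j, G.weight i j * (u i - u j) + (if R i then 1 else 0) * u i) (i : Fin n) :
    0 ≤ u i := by
  obtain ⟨k, -, hk⟩ := Finset.exists_min_image Finset.univ u ⟨i, Finset.mem_univ i⟩
  by_contra! hi
  have hk0 : u k < 0 := (hk i (Finset.mem_univ i)).trans_lt hi
  -- At a negative minimum every term is nonpositive while their sum is nonnegative, so all vanish.
  -- The minimum then spreads backwards along links until it reaches `r`.
  have hmin : ∀ m, u m = u k → ¬ R m ∧ ∀ j, G.Link j m → u j = u k := by
    intro m hm
    have hterm : ∀ j ∈ Finset.univ, G.weight m j * (u m - u j) ≤ 0 := fun j hj =>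
      mul_nonpos_of_nonneg_of_nonpos (G.weight_nonneg m j) (by linarith [hk j hj])
    have hsum := Finset.sum_nonpos hterm
    have hRm : ¬ R m := by
      intro hR
      have := hu m
      rw [if_pos hR] at this
      linarith
    refine ⟨hRm, fun j hj => ?_⟩
    have h0 := hu m
    rw [if_neg hRm, zero_mul, add_zero] at h0
    have := (Finset.sum_eq_zero_iff_of_nonpos hterm).mp (le_antisymm hsum h0) j (Finset.mem_univ j)
    rcases mul_eq_zero.mp this with h | h
    · exact absurd h (ne_of_gt hj)
    · linarith
  have hback : ∀ m, G.Reaches m k → u m = u k := by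
    intro m hm
    induction hm using Relation.ReflTransGen.head_induction_on with
    | refl => rfl
    | head h _ ih => exact (hmin _ ih).2 _ h
  exact (hmin r (hback r (hreach k))).1 hr

/-- There is a nonnegative `η` with `ηᵀ (L + diag 1_R) = 1ᵀ` if some member of `R` reaches every
agent. -/
theorem exists_nonneg_weights {R : Fin n → Prop} [DecidablePred R]
    {r : Fin n} (hr : R r) (hreach : ∀ i, G.Reaches r i) :
    ∃ η : Fin n → ℝ, (∀ i, 0 ≤ η i) ∧ ∀ q : Fin n → ℝ,
      ∑ i, η i * ∑ j, G.weight i j * (q i - q j)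
        = ∑ i, q i - ∑ i, if R i then η i * q i else 0 := by
  classical
  let B : Matrix (Fin n) (Fin n) ℝ :=
    G.laplacian + Matrix.diagonal fun i => if R i then (1 : ℝ) else 0
  have hB : ∀ u i, B.mulVec u i =
      ∑ j, G.weight i j * (u i - u j) + (if R i then 1 else 0) * u i := by
    intro u i
    simp only [B, Matrix.add_mulVec, Pi.add_apply, Matrix.mulVec_diagonal]
    rw [← G.sum_laplacian_mul]
    rfl
  have hpos : ∀ u, (∀ i, 0 ≤ B.mulVec u i) → ∀ i, 0 ≤ u i := fun u hu =>
    nonneg_of_laplacian_add_diagonal hr hreach fun i => hB u i ▸ hu i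
  have hinj : Function.Injective B.mulVec := by
    intro u v huv
    have h1 := hpos (u - v) (fun i => by simp [Matrix.mulVec_sub, huv])
    have h2 := hpos (v - u) (fun i => by simp [Matrix.mulVec_sub, huv])
    ext i
    have a1 := h1 i
    have a2 := h2 i
    simp only [Pi.sub_apply] at a1 a2
    linarith
  have hunit : IsUnit B := Matrix.mulVec_injective_iff_isUnit.mp hinj
  have hdet : IsUnit B.det := (Matrix.isUnit_iff_isUnit_det B).mp hunit
  have hinv : ∀ i j, 0 ≤ B⁻¹ i j := by
    intro i j
    refine hpos (fun i => B⁻¹ i j) (fun k => ?_) i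
    have : B.mulVec (fun i => B⁻¹ i j) k = (B * B⁻¹) k j := rfl
    rw [this, Matrix.mul_nonsing_inv B hdet, Matrix.one_apply]
    split_ifs <;> norm_num
  -- The columns of `B⁻¹` are nonnegative because `B` maps them to unit vectors; the weights are the
  -- column sums.
  refine ⟨Matrix.vecMul 1 B⁻¹, fun i => ?_, fun q => ?_⟩
  · simp only [Matrix.vecMul, dotProduct, Pi.one_apply, one_mul]
    exact Finset.sum_nonneg fun k _ => hinv k i
  · have h1 : dotProduct (Matrix.vecMul 1 B⁻¹) (B.mulVec q) = ∑ i, q i := by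
      rw [Matrix.dotProduct_mulVec, Matrix.vecMul_vecMul, Matrix.nonsing_inv_mul B hdet,
        Matrix.vecMul_one, one_dotProduct]
    rw [← h1, dotProduct, ← Finset.sum_sub_distrib]
    refine Finset.sum_congr rfl fun i _ => ?_
    rw [hB]
    split_ifs <;> ring

/-! ### The root component, its Perron vector and the dissipation inequality -/

variable {M : ℕ} {c : Fin n → Fin (M + 1)}

/-- Block upper triangularity lets links run only towards components of equal or lower number, so
none enters the last one. -/
theorem IsPerronFrobeniusForm.mem_last_of_link (hc : G.IsPerronFrobeniusForm c) {i j : Fin n}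
    (h : G.Link i j) (hj : c j = Fin.last M) : c i = Fin.last M := by
  by_contra hi
  have hlt : c i < c j := hj ▸ lt_of_le_of_ne (Fin.le_last _) hi
  have h0 := hc.upper j i hlt
  rw [G.laplacian_of_ne (fun e => hlt.ne (by rw [e]))] at h0
  exact absurd h (by simp only [Link]; linarith)

theorem IsPerronFrobeniusForm.mem_last_of_reaches (hc : G.IsPerronFrobeniusForm c) {i j : Fin n}
    (h : G.Reaches i j) (hj : c j = Fin.last M) : c i = Fin.last M := by
  induction h using Relation.ReflTransGen.head_induction_on with
  | refl => exact hj
  | head h _ ih => exact hc.mem_last_of_link h ih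

/-- The Perron vector of the last component, extended by zero. -/
def extendPerron (ξ : {i // c i = Fin.last M} → ℝ) (i : Fin n) : ℝ :=
  if h : c i = Fin.last M then ξ ⟨i, h⟩ else 0

theorem sum_extendPerron_mul (ξ : {i // c i = Fin.last M} → ℝ) (q : Fin n → ℝ) :
    ∑ i, extendPerron ξ i * q i = ∑ r, ξ r * q r.1 := by
  classical
  have h1 : ∀ r : {i // c i = Fin.last M}, ξ r = extendPerron ξ r.1 := fun r => by
    simp [extendPerron, r.2]
  simp_rw [h1]
  rw [← Finset.sum_subtype (Finset.univ.filter fun i => c i = Fin.last M) (by simp)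
    fun i => extendPerron ξ i * q i, Finset.sum_filter]
  refine Finset.sum_congr rfl fun i _ => ?_
  split_ifs with h
  · rfl
  · simp [extendPerron, h]

/-- As no link enters the last component, the rows of its block already sum to zero. -/
theorem blockTilde_last (hc : G.IsPerronFrobeniusForm c) (i j : {i // c i = Fin.last M}) :
    G.blockTilde c (Fin.last M) i j = G.laplacian i.1 j.1 := by
  classical
  unfold blockTilde block
  split_ifs with h
  · subst h
    have h0 := G.sum_laplacian i.1
    have h1 : ∑ k, G.laplacian i.1 k = ∑ k : {k // c k = Fin.last M}, G.laplacian i.1 k.1 := by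
      rw [← Finset.sum_subtype (Finset.univ.filter fun k => c k = Fin.last M) (by simp)
        fun k => G.laplacian i.1 k, Finset.sum_filter]
      refine Finset.sum_congr rfl fun k _ => ?_
      split_ifs with hk
      · rfl
      · exact hc.upper _ _ (i.2.symm ▸ lt_of_le_of_ne (Fin.le_last _) hk)
    rw [h1, ← Finset.add_sum_erase _ _ (Finset.mem_univ i)] at h0
    simp only [Matrix.submatrix_apply]
    linarith
  · rfl

variable {ξ : {i // c i = Fin.last M} → ℝ}

theorem IsPerronVector.extendPerron_nonneg (hξ : G.IsPerronVector c (Fin.last M) ξ) (i : Fin n) :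
    0 ≤ extendPerron ξ i := by
  unfold extendPerron
  split_ifs with h
  · exact (hξ.pos _).le
  · exact le_rfl

theorem IsPerronVector.extendPerron_pos (hξ : G.IsPerronVector c (Fin.last M) ξ) {i : Fin n}
    (h : c i = Fin.last M) : 0 < extendPerron ξ i := by
  rw [extendPerron, dif_pos h]
  exact hξ.pos _

theorem IsPerronVector.sum_extendPerron (hξ : G.IsPerronVector c (Fin.last M) ξ) :
    ∑ i, extendPerron ξ i = 1 := by
  simpa [hξ.sum_eq_one] using sum_extendPerron_mul ξ fun _ => 1

theorem IsPerronVector.extendPerron_left_null (hc : G.IsPerronFrobeniusForm c)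
    (hξ : G.IsPerronVector c (Fin.last M) ξ) (j : Fin n) :
    ∑ i, extendPerron ξ i * G.laplacian i j = 0 := by
  rw [sum_extendPerron_mul ξ fun i => G.laplacian i j]
  by_cases hj : c j = Fin.last M
  · have := congrFun hξ.left_null ⟨j, hj⟩
    simpa only [Matrix.vecMul, dotProduct, blockTilde_last hc, Pi.zero_apply] using this
  · refine Finset.sum_eq_zero fun r _ => ?_
    rw [hc.upper r.1 j (r.2.symm ▸ lt_of_le_of_ne (Fin.le_last _) hj), mul_zero]

theorem IsPerronVector.sum_extendPerron_mul_laplacian (hc : G.IsPerronFrobeniusForm c)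
    (hξ : G.IsPerronVector c (Fin.last M) ξ) (q : Fin n → ℝ) :
    ∑ i, extendPerron ξ i * ∑ j, G.laplacian i j * q j = 0 := by
  simp_rw [Finset.mul_sum]
  rw [Finset.sum_comm]
  refine Finset.sum_eq_zero fun j _ => ?_
  have := congrArg (· * q j) (hξ.extendPerron_left_null hc j)
  simpa [Finset.sum_mul, mul_assoc] using this

/-- The disagreement of the agents, weighted with the links inside the last component. -/
def disagreement (G : WeightedDigraph n) (ξ : {i // c i = Fin.last M} → ℝ) (u : Fin n → ℝ) : ℝ :=
  ∑ i, extendPerron ξ i * ∑ j, G.weight i j * (u i - u j) ^ 2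

theorem IsPerronVector.disagreement_nonneg (hξ : G.IsPerronVector c (Fin.last M) ξ)
    (u : Fin n → ℝ) : 0 ≤ G.disagreement ξ u :=
  Finset.sum_nonneg fun i _ => mul_nonneg (hξ.extendPerron_nonneg i)
    (Finset.sum_nonneg fun j _ => mul_nonneg (G.weight_nonneg i j) (sq_nonneg _))

theorem IsPerronVector.sq_sub_le_disagreement_of_link (hξ : G.IsPerronVector c (Fin.last M) ξ)
    {i j : Fin n} (hi : c i = Fin.last M) (hij : G.Link j i) (u : Fin n → ℝ) :
    (u i - u j) ^ 2 ≤ (extendPerron ξ i * G.weight i j)⁻¹ * G.disagreement ξ u := by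
  have hpos : 0 < extendPerron ξ i * G.weight i j := mul_pos (hξ.extendPerron_pos hi) hij
  rw [inv_mul_eq_div, le_div_iff₀ hpos]
  have h1 : ∀ i j, 0 ≤ G.weight i j * (u i - u j) ^ 2 := fun i j =>
    mul_nonneg (G.weight_nonneg i j) (sq_nonneg _)
  calc (u i - u j) ^ 2 * (extendPerron ξ i * G.weight i j)
      = extendPerron ξ i * (G.weight i j * (u i - u j) ^ 2) := by ring
    _ ≤ extendPerron ξ i * ∑ j, G.weight i j * (u i - u j) ^ 2 :=
        mul_le_mul_of_nonneg_left
          (Finset.single_le_sum (f := fun j => G.weight i j * (u i - u j) ^ 2)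
            (fun j _ => h1 i j) (Finset.mem_univ j)) (hξ.extendPerron_nonneg i)
    _ ≤ G.disagreement ξ u :=
        Finset.single_le_sum
          (f := fun i => extendPerron ξ i * ∑ j, G.weight i j * (u i - u j) ^ 2)
          (fun i _ => mul_nonneg (hξ.extendPerron_nonneg i) (Finset.sum_nonneg fun j _ => h1 i j))
          (Finset.mem_univ i)

/-- A path ending in the last component stays in it, so each of its links contributes to the
disagreement; `(a + b)² ≤ 2a² + 2b²` chains them. -/
theorem IsPerronVector.exists_sq_sub_le_disagreement (hc : G.IsPerronFrobeniusForm c)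
    (hξ : G.IsPerronVector c (Fin.last M) ξ) {i j : Fin n} (h : G.Reaches j i)
    (hi : c i = Fin.last M) :
    ∃ C, 0 ≤ C ∧ ∀ u : Fin n → ℝ, (u i - u j) ^ 2 ≤ C * G.disagreement ξ u := by
  induction h with
  | refl => exact ⟨0, le_rfl, fun u => by simp⟩
  | @tail b i _ hbi ih =>
    obtain ⟨C, hC0, hC⟩ := ih (hc.mem_last_of_link hbi hi)
    have hpos : 0 < extendPerron ξ i * G.weight i b := mul_pos (hξ.extendPerron_pos hi) hbi
    refine ⟨2 * ((extendPerron ξ i * G.weight i b)⁻¹ + C), by positivity, fun u => ?_⟩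
    have h1 := hξ.sq_sub_le_disagreement_of_link hi hbi u
    have h2 := hC u
    nlinarith [sq_nonneg ((u i - u b) - (u b - u j))]

/-- Against an agent whose value has the opposite sign or is zero, `|u i|` is at most the difference
of the two values. -/
theorem IsPerronVector.exists_sq_le_disagreement (hc : G.IsPerronFrobeniusForm c)
    (hξ : G.IsPerronVector c (Fin.last M) ξ) {i : Fin n} (hi : c i = Fin.last M) :
    ∃ C, 0 ≤ C ∧ ∀ u : Fin n → ℝ, (∃ j, c j = Fin.last M ∧ u j ≤ 0) →
      (∃ j, c j = Fin.last M ∧ 0 ≤ u j) → u i ^ 2 ≤ C * G.disagreement ξ u := by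
  have hex : ∀ j, ∃ C, 0 ≤ C ∧ (c j = Fin.last M →
      ∀ u : Fin n → ℝ, (u i - u j) ^ 2 ≤ C * G.disagreement ξ u) := by
    intro j
    by_cases hj : c j = Fin.last M
    · obtain ⟨C, h0, hC⟩ := hξ.exists_sq_sub_le_disagreement hc
        ((hc.component_iff i j).mp (hi.trans hj.symm)).2 hi
      exact ⟨C, h0, fun _ => hC⟩
    · exact ⟨0, le_rfl, fun h => absurd h hj⟩
  choose C hC0 hC using hex
  -- That agent depends on `u`; the sum serves all choices at once.
  refine ⟨∑ j, C j, Finset.sum_nonneg fun j _ => hC0 j, ?_⟩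
  rintro u ⟨j, hj, huj⟩ ⟨k, hk, huk⟩
  have hle : ∀ m, C m * G.disagreement ξ u ≤ (∑ j, C j) * G.disagreement ξ u := fun m =>
    mul_le_mul_of_nonneg_right (Finset.single_le_sum (fun j _ => hC0 j) (Finset.mem_univ m))
      (hξ.disagreement_nonneg u)
  rcases le_total 0 (u i) with h | h
  · refine le_trans ?_ ((hC j hj u).trans (hle j))
    nlinarith
  · refine le_trans ?_ ((hC k hk u).trans (hle k))
    nlinarith

/-- Weights for which the Laplacian is dissipative on vectors without strict sign on the last
component. -/
theorem exists_dissipation_weights (hG : G.HasSpanningTree) (hc : G.IsPerronFrobeniusForm c)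
    (hξ : G.IsPerronVector c (Fin.last M) ξ) :
    ∃ ζ : Fin n → ℝ, (∀ i, 0 ≤ ζ i) ∧ ∀ u : Fin n → ℝ,
      (∃ j, c j = Fin.last M ∧ u j ≤ 0) → (∃ j, c j = Fin.last M ∧ 0 ≤ u j) →
      1 / 2 * ∑ i, u i ^ 2 ≤ ∑ i, ζ i * (u i * ∑ j, G.laplacian i j * u j) := by
  classical
  obtain ⟨r, hr⟩ := hG
  obtain ⟨m, hm⟩ := hc.surjective (Fin.last M)
  have hrM : c r = Fin.last M := hc.mem_last_of_reaches (hr m) hm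
  obtain ⟨η, hη0, hη⟩ := exists_nonneg_weights (R := fun i => c i = Fin.last M) hrM hr
  have hex : ∀ i, ∃ C, 0 ≤ C ∧ (c i = Fin.last M → ∀ u : Fin n → ℝ,
      (∃ j, c j = Fin.last M ∧ u j ≤ 0) → (∃ j, c j = Fin.last M ∧ 0 ≤ u j) →
      u i ^ 2 ≤ C * G.disagreement ξ u) := by
    intro i
    by_cases hi : c i = Fin.last M
    · obtain ⟨C, h0, hC⟩ := hξ.exists_sq_le_disagreement hc hi
      exact ⟨C, h0, fun _ => hC⟩
    · exact ⟨0, le_rfl, fun h => absurd h hi⟩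
  choose C hC0 hC using hex
  have hK0 : 0 ≤ ∑ i, η i * C i := Finset.sum_nonneg fun i _ => mul_nonneg (hη0 i) (hC0 i)
  -- The weights `η` produce half of `∑ u i ^ 2` except for a loss on the root component; the
  -- multiple of the Perron vector adds enough disagreement to absorb it.
  refine ⟨fun i => η i + (∑ i, η i * C i) * extendPerron ξ i, fun i =>
    add_nonneg (hη0 i) (mul_nonneg hK0 (hξ.extendPerron_nonneg i)), fun u h1 h2 => ?_⟩
  have hsplit : ∀ i, u i * ∑ j, G.laplacian i j * u j
      = 1 / 2 * ∑ j, G.weight i j * (u i ^ 2 - u j ^ 2)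
        + 1 / 2 * ∑ j, G.weight i j * (u i - u j) ^ 2 := by
    intro i
    rw [G.sum_laplacian_mul, Finset.mul_sum, Finset.mul_sum, Finset.mul_sum,
      ← Finset.sum_add_distrib]
    exact Finset.sum_congr rfl fun j _ => by ring
  have hξ0 : ∑ i, extendPerron ξ i * ∑ j, G.weight i j * (u i ^ 2 - u j ^ 2) = 0 := by
    rw [← hξ.sum_extendPerron_mul_laplacian hc fun i => u i ^ 2]
    exact Finset.sum_congr rfl fun i _ =>
      congrArg _ (G.sum_laplacian_mul (fun i => u i ^ 2) i).symm
  have hR : (∑ i, if c i = Fin.last M then η i * u i ^ 2 else 0)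
      ≤ (∑ i, η i * C i) * G.disagreement ξ u := by
    rw [Finset.sum_mul]
    refine Finset.sum_le_sum fun i _ => ?_
    split_ifs with hi
    · rw [mul_assoc]
      exact mul_le_mul_of_nonneg_left (hC i hi u h1 h2) (hη0 i)
    · exact mul_nonneg (mul_nonneg (hη0 i) (hC0 i)) (hξ.disagreement_nonneg u)
  have hE : 0 ≤ ∑ i, η i * ∑ j, G.weight i j * (u i - u j) ^ 2 :=
    Finset.sum_nonneg fun i _ => mul_nonneg (hη0 i)
      (Finset.sum_nonneg fun j _ => mul_nonneg (G.weight_nonneg i j) (sq_nonneg _))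
  have htot : ∑ i, (η i + (∑ i, η i * C i) * extendPerron ξ i)
        * (u i * ∑ j, G.laplacian i j * u j)
      = 1 / 2 * ∑ i, η i * ∑ j, G.weight i j * (u i ^ 2 - u j ^ 2)
        + 1 / 2 * ∑ i, η i * ∑ j, G.weight i j * (u i - u j) ^ 2
        + 1 / 2 * (∑ i, η i * C i)
          * ∑ i, extendPerron ξ i * ∑ j, G.weight i j * (u i ^ 2 - u j ^ 2)
        + 1 / 2 * (∑ i, η i * C i) * G.disagreement ξ u := by
    rw [disagreement]
    simp only [hsplit]
    generalize ∑ i, η i * C i = K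
    rw [Finset.mul_sum, Finset.mul_sum, Finset.mul_sum, Finset.mul_sum,
      ← Finset.sum_add_distrib, ← Finset.sum_add_distrib, ← Finset.sum_add_distrib]
    exact Finset.sum_congr rfl fun i _ => by ring
  rw [htot, hξ0, hη fun i => u i ^ 2]
  linarith

end WeightedDigraph

/-! ### Perturbed scalar flows: bounds on the states -/

/-- The sum of the absolute values of the entries of the Laplacian. -/
def WeightedDigraph.laplacianSum {n : ℕ} (G : WeightedDigraph n) : ℝ :=
  ∑ i, ∑ j, |G.laplacian i j|

theorem WeightedDigraph.laplacianSum_nonneg {n : ℕ} (G : WeightedDigraph n) :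
    0 ≤ G.laplacianSum :=
  Finset.sum_nonneg fun _ _ => Finset.sum_nonneg fun _ _ => abs_nonneg _

theorem WeightedDigraph.abs_sum_laplacian_mul_le {n : ℕ} (G : WeightedDigraph n) {e : Fin n → ℝ}
    {K : ℝ} (he : ∀ j, |e j| ≤ K) (i : Fin n) :
    |∑ j, G.laplacian i j * e j| ≤ G.laplacianSum * K := by
  have hK : 0 ≤ K := (abs_nonneg _).trans (he i)
  calc |∑ j, G.laplacian i j * e j| ≤ ∑ j, |G.laplacian i j * e j| :=
        Finset.abs_sum_le_sum_abs _ _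
    _ ≤ ∑ j, |G.laplacian i j| * K := Finset.sum_le_sum fun j _ => by
        rw [abs_mul]
        exact mul_le_mul_of_nonneg_left (he j) (abs_nonneg _)
    _ = (∑ j, |G.laplacian i j|) * K := by rw [Finset.sum_mul]
    _ ≤ G.laplacianSum * K := mul_le_mul_of_nonneg_right
        (Finset.single_le_sum (f := fun i => ∑ j, |G.laplacian i j|)
          (fun i _ => Finset.sum_nonneg fun j _ => abs_nonneg _) (Finset.mem_univ i)) hK

/-- One coordinate of the closed-loop system on `[0, T)`: a nonlinear consensus flow with output
errors `e` of size at most `κ`. -/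
structure IsPerturbedFlow {n : ℕ} (G : WeightedDigraph n) (f : ℝ → ℝ) (κ : ℝ → ℝ) (T : EReal)
    (y e : Fin n → ℝ → ℝ) : Prop where
  continuousOn : ∀ i, ContinuousOn (y i) {s : ℝ | 0 ≤ s ∧ (s : EReal) < T}
  deriv_right : ∀ i (s : ℝ), 0 ≤ s → (s : EReal) < T →
    HasDerivWithinAt (y i) (-∑ j, G.laplacian i j * (f (y j s) + e j s)) (Ici s) s
  error_le : ∀ j (s : ℝ), 0 ≤ s → (s : EReal) < T → |e j s| ≤ κ s

namespace IsPerturbedFlow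

variable {n : ℕ} {G : WeightedDigraph n} {f κ E : ℝ → ℝ} {T : EReal} {y e : Fin n → ℝ → ℝ}

theorem continuousOn_Icc (H : IsPerturbedFlow G f κ T y e) (i : Fin n) {a t : ℝ} (ha : 0 ≤ a)
    (ht : (t : EReal) < T) : ContinuousOn (y i) (Icc a t) :=
  (H.continuousOn i).mono fun _ hs =>
    ⟨ha.trans hs.1, (EReal.coe_le_coe_iff.mpr hs.2).trans_lt ht⟩

/-- At a maximal agent the Laplacian of the monotone outputs is nonnegative, so only the errors can
raise the maximum; `E a - E t` is the integral of `κ` over `[a, t]`. -/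
theorem le_add (H : IsPerturbedFlow G f κ T y e) (hf : Monotone f)
    (hE : ∀ t, HasDerivAt E (-κ t) t) {a t θ : ℝ} (ha : 0 ≤ a) (hat : a ≤ t)
    (ht : (t : EReal) < T) (hθ : ∀ i, y i a ≤ θ) (i : Fin n) :
    y i t ≤ θ + G.laplacianSum * (E a - E t) := by
  have hB : ∀ t, HasDerivAt (fun t => θ + G.laplacianSum * (E a - E t))
      (G.laplacianSum * κ t) t := fun t => by
    simpa using (((hE t).const_sub (E a)).const_mul G.laplacianSum).const_add θ
  have hT : ∀ s ∈ Ico a t, (s : EReal) < T := fun s hs =>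
    (EReal.coe_le_coe_iff.mpr hs.2.le).trans_lt ht
  refine le_of_deriv_right_le_at_max (fun i => H.continuousOn_Icc i ha ht)
    (fun i s hs => H.deriv_right i s (ha.trans hs.1) (hT s hs))
    (fun s _ => (hB s).continuousAt.continuousWithinAt) (fun s _ => (hB s).hasDerivWithinAt)
    (fun s hs i hmax => ?_) (fun i => by simpa using hθ i) i ⟨hat, le_rfl⟩
  have h1 := G.abs_sum_laplacian_mul_le
    (fun j => H.error_le j s (ha.trans hs.1) (hT s hs)) i
  have h2 : 0 ≤ ∑ j, G.laplacian i j * f (y j s) := by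
    rw [G.sum_laplacian_mul fun j => f (y j s)]
    exact Finset.sum_nonneg fun j _ =>
      mul_nonneg (G.weight_nonneg i j) (sub_nonneg.mpr (hf (hmax j)))
  simp only [mul_add, Finset.sum_add_distrib]
  linarith [neg_abs_le (∑ j, G.laplacian i j * e j s)]

/-- The reflection turns upper bounds on states into lower ones. -/
theorem neg (H : IsPerturbedFlow G f κ T y e) :
    IsPerturbedFlow G (fun s => -f (-s)) κ T (fun i s => -y i s) (fun i s => -e i s) where
  continuousOn i := (H.continuousOn i).neg
  deriv_right i s h0 hs := by
    refine (H.deriv_right i s h0 hs).neg.congr_deriv ?_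
    rw [← Finset.sum_neg_distrib, ← Finset.sum_neg_distrib, ← Finset.sum_neg_distrib]
    exact Finset.sum_congr rfl fun j _ => by simp only [neg_neg]; ring
  error_le j s h0 hs := by simpa using H.error_le j s h0 hs

theorem abs_sub_le (H : IsPerturbedFlow G f κ T y e) (hf : Monotone f)
    (hE : ∀ t, HasDerivAt E (-κ t) t) {a t θ ε : ℝ} (ha : 0 ≤ a) (hat : a ≤ t)
    (ht : (t : EReal) < T) (hθ : ∀ i, |y i a - θ| ≤ ε) (i : Fin n) :
    |y i t - θ| ≤ ε + G.laplacianSum * (E a - E t) := by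
  have h1 := H.le_add hf hE ha hat ht (θ := θ + ε) (fun i => by linarith [(abs_le.mp (hθ i)).2]) i
  have h2 := H.neg.le_add (fun a b hab => neg_le_neg (hf (neg_le_neg hab))) hE ha hat ht
    (θ := -θ + ε) (fun i => by linarith [(abs_le.mp (hθ i)).1]) i
  rw [abs_le]
  constructor <;> linarith

theorem exists_bound (H : IsPerturbedFlow G f κ T y e) (hf : Monotone f)
    (hE : ∀ t, HasDerivAt E (-κ t) t) (hE0 : ∀ t, 0 ≤ E t) :
    ∃ K, 0 ≤ K ∧ ∀ i (t : ℝ), 0 ≤ t → (t : EReal) < T → |y i t| ≤ K := by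
  refine ⟨∑ j, |y j 0| + G.laplacianSum * E 0, add_nonneg
    (Finset.sum_nonneg fun _ _ => abs_nonneg _) (mul_nonneg G.laplacianSum_nonneg (hE0 0)),
    fun i t h0 ht => ?_⟩
  have := H.abs_sub_le hf hE le_rfl h0 ht (θ := 0) (ε := ∑ j, |y j 0|) (fun i => by
    rw [sub_zero]
    exact Finset.single_le_sum (f := fun j => |y j 0|) (fun _ _ => abs_nonneg _)
      (Finset.mem_univ i)) i
  rw [sub_zero] at this
  nlinarith [mul_nonneg G.laplacianSum_nonneg (hE0 t)]

/-! ### Conserved average, Lyapunov function and convergence -/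

variable {M : ℕ} {c : Fin n → Fin (M + 1)} {ξ : {i // c i = Fin.last M} → ℝ}

open WeightedDigraph

/-- The weighted average over the last component is a constant of motion. -/
theorem average_eq (H : IsPerturbedFlow G f κ T y e) (hc : G.IsPerronFrobeniusForm c)
    (hξ : G.IsPerronVector c (Fin.last M) ξ) {t : ℝ} (h0 : 0 ≤ t) (ht : (t : EReal) < T) :
    ∑ i, extendPerron ξ i * y i t = ∑ i, extendPerron ξ i * y i 0 := by
  refine constant_of_has_deriv_right_zero (f := fun t => ∑ i, extendPerron ξ i * y i t)
    (continuousOn_finsetSum _ fun i _ =>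
      continuousOn_const.mul (H.continuousOn_Icc i le_rfl ht)) (fun s hs => ?_) t ⟨h0, le_rfl⟩
  have hsT : (s : EReal) < T := (EReal.coe_le_coe_iff.mpr hs.2.le).trans_lt ht
  refine (HasDerivWithinAt.fun_sum fun i _ =>
    (H.deriv_right i s hs.1 hsT).const_mul (extendPerron ξ i)).congr_deriv ?_
  have := hξ.sum_extendPerron_mul_laplacian hc fun j => f (y j s) + e j s
  simp only [mul_neg, Finset.sum_neg_distrib, this, neg_zero]

/-- Some agent of the last component is not above the weighted average. -/
theorem _root_.EventTriggered.WeightedDigraph.IsPerronVector.exists_le_average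
    (hξ : G.IsPerronVector c (Fin.last M) ξ) (q : Fin n → ℝ) :
    ∃ j, c j = Fin.last M ∧ q j ≤ ∑ i, extendPerron ξ i * q i := by
  by_contra! hcon
  set θ := ∑ i, extendPerron ξ i * q i with hθ
  have h1 : ∑ i, extendPerron ξ i * (q i - θ) = 0 := by
    simp only [mul_sub, Finset.sum_sub_distrib, ← Finset.sum_mul, hξ.sum_extendPerron]
    linarith
  have hterm : ∀ i ∈ Finset.univ, 0 ≤ extendPerron ξ i * (q i - θ) := by
    intro i _
    by_cases hi : c i = Fin.last M
    · exact mul_nonneg (hξ.extendPerron_nonneg i) (sub_nonneg.mpr (hcon i hi).le)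
    · simp [extendPerron, hi]
  have h2 := (Finset.sum_eq_zero_iff_of_nonneg hterm).mp h1
  have h3 : ∀ i, extendPerron ξ i = 0 := by
    intro i
    by_cases hi : c i = Fin.last M
    · rcases mul_eq_zero.mp (h2 i (Finset.mem_univ i)) with h | h
      · exact h
      · linarith [hcon i hi]
    · simp [extendPerron, hi]
  have h4 := hξ.sum_extendPerron
  simp [h3] at h4

/-- Some agent of the last component is not below the weighted average. -/
theorem _root_.EventTriggered.WeightedDigraph.IsPerronVector.exists_average_le
    (hξ : G.IsPerronVector c (Fin.last M) ξ) (q : Fin n → ℝ) :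
    ∃ j, c j = Fin.last M ∧ ∑ i, extendPerron ξ i * q i ≤ q j := by
  obtain ⟨j, hj, h⟩ := hξ.exists_le_average fun i => -q i
  refine ⟨j, hj, ?_⟩
  simp only [mul_neg, Finset.sum_neg_distrib] at h
  linarith

/-- The integral of `f - f θ` from `θ`. -/
def _root_.EventTriggered.potential (f : ℝ → ℝ) (θ x : ℝ) : ℝ := ∫ s in θ..x, (f s - f θ)

theorem _root_.EventTriggered.hasDerivAt_potential (hf : Continuous f) (θ x : ℝ) :
    HasDerivAt (potential f θ) (f x - f θ) x :=
  intervalIntegral.integral_hasDerivAt_right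
    ((hf.sub continuous_const).intervalIntegrable _ _)
    ((hf.sub continuous_const).stronglyMeasurableAtFilter _ _)
    (hf.sub continuous_const).continuousAt

theorem _root_.EventTriggered.potential_nonneg (hf : Monotone f) (θ x : ℝ) :
    0 ≤ potential f θ x := by
  unfold potential
  rcases le_total θ x with h | h
  · exact intervalIntegral.integral_nonneg h fun s hs => sub_nonneg.mpr (hf hs.1)
  · rw [intervalIntegral.integral_symm, ← intervalIntegral.integral_neg]
    exact intervalIntegral.integral_nonneg h fun s hs => by linarith [hf hs.2]

/-- The outputs of all agents are close to the output of the average at arbitrarily late times. -/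
theorem exists_sum_sq_lt (H : IsPerturbedFlow G f κ ⊤ y e) (hG : G.HasSpanningTree)
    (hc : G.IsPerronFrobeniusForm c) (hξ : G.IsPerronVector c (Fin.last M) ξ)
    (hf : Monotone f) (hfc : Continuous f) (hE : ∀ t, HasDerivAt E (-κ t) t)
    (hE0 : ∀ t, 0 ≤ E t) {t₀ δ : ℝ} (h0 : 0 ≤ t₀) (hδ : 0 < δ) :
    ∃ t, t₀ ≤ t ∧ ∑ i, (f (y i t) - f (∑ i, extendPerron ξ i * y i 0)) ^ 2 < δ := by
  set θ := ∑ i, extendPerron ξ i * y i 0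
  by_contra! hcon
  obtain ⟨ζ, hζ0, hζ⟩ := exists_dissipation_weights hG hc hξ
  obtain ⟨K, hK0, hK⟩ := H.exists_bound hf hE hE0
  have hfK : ∀ i t, 0 ≤ t → |f (y i t) - f θ| ≤ |f K| + |f (-K)| + |f θ| := by
    intro i t ht
    have := abs_le.mp (hK i t ht (EReal.coe_lt_top t))
    have h1 := hf this.1
    have h2 := hf this.2
    rw [abs_le]
    constructor <;>
      linarith [le_abs_self (f K), neg_abs_le (f (-K)), le_abs_self (f θ), neg_abs_le (f θ),
        abs_nonneg (f K), abs_nonneg (f (-K))]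
  set F := |f K| + |f (-K)| + |f θ|
  have hκ : ∀ t, 0 ≤ t → ∀ j, |e j t| ≤ κ t := fun t ht j =>
    H.error_le j t ht (EReal.coe_lt_top t)
  set C := ∑ i, ζ i * (F * G.laplacianSum) with hC
  -- If the sum of squares never fell below `δ`, the Lyapunov function would decrease linearly, up
  -- to the integrated error.
  have hW : ∀ t, t₀ ≤ t → ∑ i, ζ i * potential f θ (y i t)
      ≤ ∑ i, ζ i * potential f θ (y i t₀) - δ / 2 * (t - t₀) + C * (E t₀ - E t) := by
    intro t ht
    have hB : ∀ s, HasDerivAt (fun t => ∑ i, ζ i * potential f θ (y i t₀) - δ / 2 * (t - t₀)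
        + C * (E t₀ - E t)) (- (δ / 2) + C * κ s) s := by
      intro s
      have h1 := ((((hasDerivAt_id s).sub_const t₀).const_mul (δ / 2)).const_sub
        (∑ i, ζ i * potential f θ (y i t₀))).fun_add (((hE s).const_sub (E t₀)).const_mul C)
      simpa using h1
    refine image_le_of_deriv_right_le_deriv_boundary
      (f := fun s => ∑ i, ζ i * potential f θ (y i s))
      (f' := fun s => ∑ i, ζ i * ((f (y i s) - f θ)
        * (-∑ j, G.laplacian i j * (f (y j s) + e j s))))
      (B' := fun s => - (δ / 2) + C * κ s) ?_ ?_ (by simp)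
      (fun s _ => (hB s).continuousAt.continuousWithinAt)
      (fun s _ => (hB s).hasDerivWithinAt) ?_ ⟨ht, le_rfl⟩
    · refine continuousOn_finsetSum _ fun i _ => continuousOn_const.mul ?_
      have hpc : Continuous (potential f θ) :=
        continuous_iff_continuousAt.mpr fun x => (hasDerivAt_potential hfc θ x).continuousAt
      exact hpc.comp_continuousOn (H.continuousOn_Icc i h0 (EReal.coe_lt_top t))
    · intro s hs
      refine HasDerivWithinAt.fun_sum fun i _ => HasDerivWithinAt.const_mul _ ?_
      exact (hasDerivAt_potential hfc θ (y i s)).comp_hasDerivWithinAt s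
        (H.deriv_right i s (h0.trans hs.1) (EReal.coe_lt_top s))
    · intro s hs
      have hs0 := h0.trans hs.1
      have hav := H.average_eq hc hξ hs0 (EReal.coe_lt_top s)
      obtain ⟨j, hj, hjle⟩ := hξ.exists_le_average fun i => y i s
      obtain ⟨k, hk, hkle⟩ := hξ.exists_average_le fun i => y i s
      have hdis := hζ (fun i => f (y i s) - f θ)
        ⟨j, hj, sub_nonpos.mpr (hf (hjle.trans_eq hav))⟩
        ⟨k, hk, sub_nonneg.mpr (hf (hav.symm.trans_le hkle))⟩
      have hδs := hcon s hs.1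
      -- Zero row sums allow the constant `f θ` to be subtracted from all outputs.
      have hlap : ∀ i, ∑ j, G.laplacian i j * (f (y j s) + e j s)
          = ∑ j, G.laplacian i j * (f (y j s) - f θ) + ∑ j, G.laplacian i j * e j s := by
        intro i
        simp only [mul_add, mul_sub, Finset.sum_add_distrib, Finset.sum_sub_distrib,
          ← Finset.sum_mul, G.sum_laplacian, zero_mul, sub_zero]
      have herr : ∑ i, ζ i * -((f (y i s) - f θ) * ∑ j, G.laplacian i j * e j s) ≤ C * κ s := by
        rw [hC, Finset.sum_mul]
        refine Finset.sum_le_sum fun i _ => ?_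
        rw [mul_assoc]
        refine mul_le_mul_of_nonneg_left ?_ (hζ0 i)
        refine (neg_le_abs _).trans ?_
        rw [abs_mul, mul_assoc]
        exact mul_le_mul (hfK i s hs0) (G.abs_sum_laplacian_mul_le (hκ s hs0) i) (abs_nonneg _)
          ((abs_nonneg _).trans (hfK i s hs0))
      have hsum : ∑ i, ζ i * ((f (y i s) - f θ)
            * (-∑ j, G.laplacian i j * (f (y j s) + e j s)))
          = -∑ i, ζ i * ((f (y i s) - f θ) * ∑ j, G.laplacian i j * (f (y j s) - f θ))
            + ∑ i, ζ i * -((f (y i s) - f θ) * ∑ j, G.laplacian i j * e j s) := by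
        rw [← Finset.sum_neg_distrib, ← Finset.sum_add_distrib]
        exact Finset.sum_congr rfl fun i _ => by rw [hlap]; ring
      simp only [hsum]
      linarith
  have hF0 : ∀ i, 0 ≤ ζ i * (F * G.laplacianSum) := fun i => mul_nonneg (hζ0 i)
    (mul_nonneg ((abs_nonneg _).trans (hfK i 0 le_rfl)) G.laplacianSum_nonneg)
  have hC0 : 0 ≤ C := Finset.sum_nonneg fun i _ => hF0 i
  set W := ∑ i, ζ i * potential f θ (y i t₀)
  have hW0 : 0 ≤ W := Finset.sum_nonneg fun i _ =>
    mul_nonneg (hζ0 i) (potential_nonneg hf θ _)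
  have hX : 0 ≤ (W + C * E t₀ + 1) * (2 / δ) :=
    mul_nonneg (by nlinarith [mul_nonneg hC0 (hE0 t₀)]) (by positivity)
  -- At this time the upper bound is at most `-1`, against nonnegativity of the Lyapunov function.
  have hfin := hW (t₀ + (W + C * E t₀ + 1) * (2 / δ)) (by linarith)
  have hpos : 0 ≤ ∑ i, ζ i * potential f θ (y i (t₀ + (W + C * E t₀ + 1) * (2 / δ))) :=
    Finset.sum_nonneg fun i _ => mul_nonneg (hζ0 i) (potential_nonneg hf θ _)
  have hcalc : δ / 2 * (t₀ + (W + C * E t₀ + 1) * (2 / δ) - t₀) = W + C * E t₀ + 1 := by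
    rw [add_sub_cancel_left]
    field_simp
  rw [hcalc] at hfin
  have := mul_nonneg hC0 (hE0 (t₀ + (W + C * E t₀ + 1) * (2 / δ)))
  linarith

/-- One late time with all states near the average suffices: afterwards the deviation grows at most
by the remaining error integral, which is small. -/
theorem tendsto_average {h : ℝ} (H : IsPerturbedFlow G f κ ⊤ y e) (hG : G.HasSpanningTree)
    (hc : G.IsPerronFrobeniusForm c) (hξ : G.IsPerronVector c (Fin.last M) ξ)
    (hf : OutputAssumption f h) (hE : ∀ t, HasDerivAt E (-κ t) t) (hE0 : ∀ t, 0 ≤ E t)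
    (hElim : Tendsto E atTop (𝓝 0)) (hh : |∑ i, extendPerron ξ i * y i 0| < h) (i : Fin n) :
    Tendsto (y i) atTop (𝓝 (∑ i, extendPerron ξ i * y i 0)) := by
  set θ := ∑ i, extendPerron ξ i * y i 0 with hθ
  obtain ⟨hh1, hh2⟩ := abs_lt.mp hh
  rw [Metric.tendsto_atTop]
  intro ε hε
  -- The last two bounds keep `θ ± ρ` in `[-h, h]`, where `f` is strictly increasing; beyond `θ ± ρ`
  -- plain monotonicity is enough.
  obtain ⟨ρ, hρ0, hρε, hρ1, hρ2⟩ : ∃ ρ, 0 < ρ ∧ ρ ≤ ε / 2 ∧ ρ ≤ h - θ ∧ ρ ≤ h + θ :=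
    ⟨min (ε / 2) (min (h - θ) (h + θ)),
      lt_min (by linarith) (lt_min (by linarith) (by linarith)), min_le_left _ _,
      (min_le_right _ _).trans (min_le_left _ _), (min_le_right _ _).trans (min_le_right _ _)⟩
  have hmem : θ ∈ Icc (-h) h := ⟨hh1.le, hh2.le⟩
  have hup : 0 < f (θ + ρ) - f θ := sub_pos.mpr
    (hf.strictMonoOn hmem ⟨by linarith, by linarith⟩ (by linarith))
  have hdown : 0 < f θ - f (θ - ρ) := sub_pos.mpr
    (hf.strictMonoOn ⟨by linarith, by linarith⟩ hmem (by linarith))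
  obtain ⟨δ, hδ0, hδ1, hδ2⟩ : ∃ δ, 0 < δ ∧ δ ≤ f (θ + ρ) - f θ ∧ δ ≤ f θ - f (θ - ρ) :=
    ⟨min _ _, lt_min hup hdown, min_le_left _ _, min_le_right _ _⟩
  have hEv : ∀ᶠ t in atTop, G.laplacianSum * E t < ε / 2 := by
    have : Tendsto (fun t => G.laplacianSum * E t) atTop (𝓝 0) := by
      simpa using hElim.const_mul G.laplacianSum
    exact this.eventually_lt_const (by linarith)
  obtain ⟨t₀, ht₀⟩ := eventually_atTop.mp hEv
  obtain ⟨t₁, ht₁, hsum⟩ := H.exists_sum_sq_lt hG hc hξ hf.monotone hf.continuous hE hE0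
    (le_max_right t₀ 0) (pow_pos hδ0 2)
  rw [← hθ] at hsum
  have h01 : 0 ≤ t₁ := (le_max_right _ _).trans ht₁
  have hclose : ∀ i, |y i t₁ - θ| ≤ ρ := by
    intro i
    have h1 : (f (y i t₁) - f θ) ^ 2 < δ ^ 2 := lt_of_le_of_lt
      (Finset.single_le_sum (f := fun i => (f (y i t₁) - f θ) ^ 2)
        (fun _ _ => sq_nonneg _) (Finset.mem_univ i)) hsum
    obtain ⟨h2, h3⟩ := abs_lt.mp (abs_lt_of_sq_lt_sq h1 hδ0.le)
    rw [abs_le]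
    constructor
    · by_contra! hlt
      have := hf.monotone (show y i t₁ ≤ θ - ρ by linarith)
      linarith
    · by_contra! hlt
      have := hf.monotone (show θ + ρ ≤ y i t₁ by linarith)
      linarith
  refine ⟨t₁, fun t ht => ?_⟩
  have h1 := H.abs_sub_le hf.monotone hE h01 ht (EReal.coe_lt_top t) hclose i
  have h2 := ht₀ t₁ ((le_max_left _ _).trans ht₁)
  have h3 := mul_nonneg G.laplacianSum_nonneg (hE0 t)
  rw [Real.dist_eq]
  linarith

end IsPerturbedFlow

/-- Bounded states and errors bound the velocity, and `f` is Lipschitz on the compact range of the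
states. -/
theorem IsPerturbedFlow.exists_output_lipschitz {n : ℕ} {G : WeightedDigraph n} {f κ E : ℝ → ℝ}
    {T : EReal} {y e : Fin n → ℝ → ℝ} {h : ℝ} (H : IsPerturbedFlow G f κ T y e)
    (hf : OutputAssumption f h) (hE : ∀ t, HasDerivAt E (-κ t) t) (hE0 : ∀ t, 0 ≤ E t)
    (hκ : ∀ t, 0 ≤ t → κ t ≤ κ 0) :
    ∃ N, ∀ i (a b : ℝ), 0 ≤ a → a ≤ b → (b : EReal) < T →
      |f (y i a) - f (y i b)| ≤ N * (b - a) := by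
  obtain ⟨K, hK0, hK⟩ := H.exists_bound hf.monotone hE hE0
  obtain ⟨Λ, hΛ0, hΛ⟩ := hf.lipschitz (Icc (-K) K) isCompact_Icc
  refine ⟨Λ * (G.laplacianSum * (|f K| + |f (-K)| + κ 0)), fun i a b ha hab hb => ?_⟩
  have hT : ∀ s, s ≤ b → (s : EReal) < T := fun s hs =>
    (EReal.coe_le_coe_iff.mpr hs).trans_lt hb
  have hy : ‖y i b - y i a‖ ≤ G.laplacianSum * (|f K| + |f (-K)| + κ 0) * (b - a) := by
    refine norm_image_sub_le_of_norm_deriv_right_le_segment (H.continuousOn_Icc i ha hb)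
      (fun s hs => H.deriv_right i s (ha.trans hs.1) (hT s hs.2.le)) (fun s hs => ?_) b ⟨hab, le_rfl⟩
    have hs0 := ha.trans hs.1
    rw [norm_neg, Real.norm_eq_abs]
    refine G.abs_sum_laplacian_mul_le (fun j => (abs_add_le _ _).trans ?_) i
    refine add_le_add ?_ ((H.error_le j s hs0 (hT s hs.2.le)).trans (hκ s hs0))
    have h1 := abs_le.mp (hK j s hs0 (hT s hs.2.le))
    have h2 := hf.monotone h1.1
    have h3 := hf.monotone h1.2
    rw [abs_le]
    constructor <;>
      linarith [le_abs_self (f K), neg_abs_le (f (-K)), abs_nonneg (f K), abs_nonneg (f (-K))]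
  have h1 := hΛ (y i a) (abs_le.mp (hK i a ha (hT a hab))) (y i b)
    (abs_le.mp (hK i b (ha.trans hab) hb))
  rw [abs_sub_comm (y i a), ← Real.norm_eq_abs (y i b - y i a)] at h1
  calc _ ≤ _ := h1
    _ ≤ _ := mul_le_mul_of_nonneg_left hy hΛ0.le
    _ = _ := by ring

/-! ### An integrable envelope for the output errors -/

/-- A common bound for the coordinates of the output errors of all agents. -/
def errorEnvelope {n : ℕ} (α β : Fin n → ℝ) (t : ℝ) : ℝ :=
  ∑ j, √(α j) * Real.exp (-(β j / 2) * t)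

/-- The integral of `errorEnvelope` over `[t, ∞)`. -/
def errorTail {n : ℕ} (α β : Fin n → ℝ) (t : ℝ) : ℝ :=
  ∑ j, √(α j) * (2 / β j) * Real.exp (-(β j / 2) * t)

section

variable {n : ℕ} {α β : Fin n → ℝ}

theorem hasDerivAt_errorTail (hβ : ∀ i, 0 < β i) (t : ℝ) :
    HasDerivAt (errorTail α β) (-errorEnvelope α β t) t := by
  have h1 : ∀ j ∈ Finset.univ, HasDerivAt
      (fun t => √(α j) * (2 / β j) * Real.exp (-(β j / 2) * t))
      (-(√(α j) * Real.exp (-(β j / 2) * t))) t := by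
    intro j _
    have h2 := (((hasDerivAt_id t).const_mul (-(β j / 2))).exp).const_mul (√(α j) * (2 / β j))
    refine h2.congr_deriv ?_
    have := (hβ j).ne'
    simp only [id]
    field_simp
  exact (HasDerivAt.fun_sum h1).congr_deriv (by simp [errorEnvelope])

theorem errorTail_nonneg (hβ : ∀ i, 0 < β i) (t : ℝ) : 0 ≤ errorTail α β t :=
  Finset.sum_nonneg fun j _ => by
    have := hβ j
    positivity

theorem tendsto_errorTail (hβ : ∀ i, 0 < β i) : Tendsto (errorTail α β) atTop (𝓝 0) := by
  have : Tendsto (errorTail α β) atTop (𝓝 (∑ j, √(α j) * (2 / β j) * 0)) := by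
    refine tendsto_finsetSum _ fun j _ => Tendsto.const_mul _ ?_
    refine Real.tendsto_exp_atBot.comp ?_
    exact tendsto_id.const_mul_atTop_of_neg (by linarith [hβ j])
  simpa using this

theorem errorEnvelope_le (hβ : ∀ i, 0 < β i) {t : ℝ} (ht : 0 ≤ t) :
    errorEnvelope α β t ≤ errorEnvelope α β 0 := by
  refine Finset.sum_le_sum fun j _ => mul_le_mul_of_nonneg_left ?_ (Real.sqrt_nonneg _)
  rw [Real.exp_le_exp]
  nlinarith [hβ j]

end

/-! ### From the triggering law to perturbed flows and triggering gaps -/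

namespace IsTrajectory

variable {n p : ℕ} {G : WeightedDigraph n} {g : Fin p → ℝ → ℝ} {α β : Fin n → ℝ} {T : EReal}
  {x : Fin n → ℝ → EuclideanSpace ℝ (Fin p)} {τ : Fin n → ℕ → EReal}

theorem exists_eq_coe (hx : IsTrajectory G g α β T x τ) {i : Fin n} {k : ℕ} {s : ℝ}
    (h : τ i k ≤ (s : EReal)) : ∃ a : ℝ, 0 ≤ a ∧ a ≤ s ∧ τ i k = (a : EReal) := by
  have h0 : (0 : EReal) ≤ τ i k := hx.first i ▸ hx.monotone i (Nat.zero_le k)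
  have hc : ((τ i k).toReal : EReal) = τ i k := EReal.coe_toReal
    (ne_top_of_le_ne_top (EReal.coe_ne_top s) h) (ne_bot_of_le_ne_bot EReal.zero_ne_bot h0)
  refine ⟨(τ i k).toReal, ?_, ?_, hc.symm⟩
  · rw [← hc] at h0
    exact_mod_cast h0
  · rw [← hc] at h
    exact_mod_cast h

/-- Time `s` lies between the last triggering and the next one, where the law enforces the bound. -/
theorem norm_sampled_sub_le (hx : IsTrajectory G g α β T x τ) (i : Fin n) {s : ℝ} (h0 : 0 ≤ s)
    (hs : (s : EReal) < T) :
    ‖output g (sampled (x i) (τ i) s) - output g (x i s)‖ ^ 2 ≤ α i * Real.exp (-β i * s) := by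
  have hbdd := hx.last i s h0 hs
  have hmem : lastIndex (τ i) s ∈ {k | τ i k ≤ (s : EReal)} :=
    Nat.sSup_mem ⟨0, by
      rw [mem_ofPred_eq, hx.first i]
      exact_mod_cast h0⟩ hbdd
  have hnext : (s : EReal) < τ i (lastIndex (τ i) s + 1) := by
    by_contra! hcon
    exact absurd (le_csSup hbdd hcon) (by simp [lastIndex])
  obtain ⟨a, ha0, has, hτ⟩ := hx.exists_eq_coe hmem
  have hsam : sampled (x i) (τ i) s = x i a := by simp [sampled, hτ]
  rw [hsam]
  rcases hx.trigger i _ a hτ ((EReal.coe_le_coe_iff.mpr has).trans_lt hs) with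
    ⟨b, hb, -, z, -, hz, hgr⟩ | ⟨-, hall⟩
  · rw [hb, EReal.coe_lt_coe_iff] at hnext
    have := hgr.1.2 s ⟨has, hnext.le⟩
    rwa [ErrorBound, hz ⟨le_rfl, has.trans hnext.le⟩, hz ⟨has, hnext.le⟩] at this
  · exact hall s has hs

/-- The coordinates interact only through the triggering times. The norm bound controls each
coordinate error, and the square root halves the exponent. -/
theorem isPerturbedFlow (hx : IsTrajectory G g α β T x τ) (l : Fin p) :
    IsPerturbedFlow G (g l) (errorEnvelope α β) T (fun i s => x i s l)
      (fun i s => g l (sampled (x i) (τ i) s l) - g l (x i s l)) where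
  continuousOn i := (EuclideanSpace.proj (𝕜 := ℝ) l).continuous.comp_continuousOn
    (hx.continuousOn i)
  deriv_right i s h0 hs := by
    refine ((EuclideanSpace.proj (𝕜 := ℝ) l).hasFDerivAt.comp_hasDerivWithinAt s
      (hx.deriv_right i s h0 hs)).congr_deriv ?_
    simp [input, output]
  error_le j s h0 hs := by
    have h1 := hx.norm_sampled_sub_le j h0 hs
    have h2 : |g l (sampled (x j) (τ j) s l) - g l (x j s l)|
        ≤ ‖output g (sampled (x j) (τ j) s) - output g (x j s)‖ := by
      simpa [output] using
        PiLp.norm_apply_le (output g (sampled (x j) (τ j) s) - output g (x j s)) l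
    have h3 : α j * Real.exp (-β j * s) ≤ (√(α j) * Real.exp (-(β j / 2) * s)) ^ 2 := by
      rw [mul_pow, ← Real.exp_nat_mul]
      have : ((2 : ℕ) : ℝ) * (-(β j / 2) * s) = -β j * s := by push_cast; ring
      rw [this]
      refine mul_le_mul_of_nonneg_right ?_ (Real.exp_pos _).le
      rcases le_total 0 (α j) with h | h
      · exact (Real.sq_sqrt h).ge
      · exact h.trans (sq_nonneg _)
    have h4 := abs_le_of_sq_le_sq (h1.trans h3) (by positivity)
    rw [abs_norm] at h4
    refine h2.trans (h4.trans ?_)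
    exact Finset.single_le_sum (f := fun j => √(α j) * Real.exp (-(β j / 2) * s))
      (fun _ _ => by positivity) (Finset.mem_univ j)

/-- The error bound is exhausted at each triggering time. -/
theorem le_norm_sub (hx : IsTrajectory G g α β T x τ) (hg : ∀ l, Continuous (g l)) {i : Fin n}
    {k : ℕ} {a b : ℝ} (ha : τ i k = (a : EReal)) (hb : τ i (k + 1) = (b : EReal))
    (hbT : (b : EReal) < T) :
    α i * Real.exp (-β i * b) ≤ ‖output g (x i a) - output g (x i b)‖ ^ 2 := by
  have hab : a ≤ b := by
    have := hx.monotone i (Nat.le_succ k)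
    rw [Nat.succ_eq_add_one, ha, hb] at this
    exact_mod_cast this
  rcases hx.trigger i k a ha ((EReal.coe_le_coe_iff.mpr hab).trans_lt hbT) with
    ⟨b', hb', -, z, hzc, hz, hgr⟩ | ⟨hT, -⟩
  · obtain rfl : b = b' := by
      rw [hb] at hb'
      exact_mod_cast hb'
    -- A strict inequality at `b` would persist along the continuous motion `z` a little past `b`,
    -- against maximality of `b`.
    by_contra! hlt
    rw [← hz ⟨le_rfl, hab⟩, ← hz ⟨hab, le_rfl⟩] at hlt
    have hout : Continuous fun s => output g (z s) := by
      unfold output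
      refine (PiLp.continuous_toLp 2 _).comp (continuous_pi fun l => (hg l).comp ?_)
      exact (EuclideanSpace.proj (𝕜 := ℝ) l).continuous.comp hzc
    have hev : ∀ᶠ s in 𝓝 b, ErrorBound g (α i) (β i) z a s := by
      have hcl : Continuous fun s => ‖output g (z a) - output g (z s)‖ ^ 2 := by fun_prop
      have hcr : Continuous fun s => α i * Real.exp (-β i * s) := by fun_prop
      filter_upwards [(isOpen_lt hcl hcr).mem_nhds hlt] with s hs
      exact le_of_lt hs
    obtain ⟨ε, hε, hball⟩ := Metric.eventually_nhds_iff.mp hev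
    have hmem : b + ε / 2 ∈ {r | a ≤ r ∧ ∀ s ∈ Icc a r, ErrorBound g (α i) (β i) z a s} := by
      refine ⟨by linarith, fun s hs => ?_⟩
      rcases le_or_gt s b with h | h
      · exact hgr.1.2 s ⟨hs.1, h⟩
      · refine hball ?_
        rw [Real.dist_eq, abs_lt]
        constructor <;> linarith [hs.2]
    have := hgr.2 hmem
    linarith
  · rw [hb] at hT
    exact absurd hbT hT.not_gt

/-- Between triggerings the output error must grow from zero to a threshold bounded below on times
up to `B`, while its speed is bounded. -/
theorem exists_gap {h : ℝ} (hx : IsTrajectory G g α β T x τ)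
    (hg : ∀ l, OutputAssumption (g l) h) (hα : ∀ i, 0 < α i) (hβ : ∀ i, 0 < β i) (i : Fin n)
    (B : ℝ) :
    ∃ δ > 0, ∀ k (a b : ℝ), τ i k = (a : EReal) → τ i (k + 1) = (b : EReal) →
      (b : EReal) < T → b ≤ B → δ ≤ b - a := by
  choose N hN using fun l => (hx.isPerturbedFlow l).exists_output_lipschitz (hg l)
    (hasDerivAt_errorTail hβ) (errorTail_nonneg hβ) (fun t ht => errorEnvelope_le hβ ht)
  -- The summand `1` keeps the divisor positive even if all `N l` vanish.
  set S := ∑ l, N l ^ 2 + 1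
  have hS : 0 < S := add_pos_of_nonneg_of_pos (Finset.sum_nonneg fun _ _ => sq_nonneg _) one_pos
  have hm : 0 < α i * Real.exp (-β i * B) := mul_pos (hα i) (Real.exp_pos _)
  refine ⟨√(α i * Real.exp (-β i * B) / S), Real.sqrt_pos.mpr (div_pos hm hS),
    fun k a b ha hb hbT hbB => ?_⟩
  have hab : a ≤ b := by
    have := hx.monotone i (Nat.le_succ k)
    rw [Nat.succ_eq_add_one, ha, hb] at this
    exact_mod_cast this
  have ha0 : 0 ≤ a := by
    have := hx.monotone i (Nat.zero_le k)
    rw [hx.first i, ha] at this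
    exact_mod_cast this
  have h1 := hx.le_norm_sub (fun l => (hg l).continuous) ha hb hbT
  have h2 : ‖output g (x i a) - output g (x i b)‖ ^ 2 ≤ S * (b - a) ^ 2 := by
    rw [EuclideanSpace.norm_sq_eq]
    calc ∑ l, ‖(output g (x i a) - output g (x i b)) l‖ ^ 2
        ≤ ∑ l, N l ^ 2 * (b - a) ^ 2 := by
          refine Finset.sum_le_sum fun l _ => ?_
          rw [← mul_pow]
          exact pow_le_pow_left₀ (norm_nonneg _) (hN l i a b ha0 hab hbT) 2
      _ = (∑ l, N l ^ 2) * (b - a) ^ 2 := by rw [Finset.sum_mul]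
      _ ≤ S * (b - a) ^ 2 := mul_le_mul_of_nonneg_right (by simp [S]) (sq_nonneg _)
  have h3 : α i * Real.exp (-β i * B) ≤ α i * Real.exp (-β i * b) := by
    refine mul_le_mul_of_nonneg_left (Real.exp_le_exp.mpr ?_) (hα i).le
    nlinarith [hβ i]
  refine Real.sqrt_le_iff.mpr ⟨sub_nonneg.mpr hab, ?_⟩
  rw [div_le_iff₀ hS]
  linarith

theorem noZeno {h : ℝ} (hx : IsTrajectory G g α β T x τ)
    (hg : ∀ l, OutputAssumption (g l) h) (hα : ∀ i, 0 < α i) (hβ : ∀ i, 0 < β i) :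
    NoZeno T τ := by
  intro i B
  obtain ⟨δ, hδ, hgap⟩ := hx.exists_gap hg hα hβ i B
  -- Adding up the gaps bounds the number of events before `B` by `B / δ`, apart from the event at
  -- time zero.
  have key : ∀ (k : ℕ) (b : ℝ), τ i k = (b : EReal) → b ≤ B → (b : EReal) < T → k * δ ≤ b := by
    intro k
    induction k with
    | zero =>
      intro b hb _ _
      rw [hx.first i] at hb
      have : (0 : ℝ) = b := by exact_mod_cast hb
      simp [← this]
    | succ k ih =>
      intro b hb hbB hbT
      obtain ⟨a, -, hab, ha⟩ := hx.exists_eq_coe ((hx.monotone i (Nat.le_succ k)).trans hb.le)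
      have h1 := ih a ha (hab.trans hbB) ((EReal.coe_le_coe_iff.mpr hab).trans_lt hbT)
      have h2 := hgap k a b ha hb hbT hbB
      push_cast
      linarith
  refine (Set.finite_Iic ⌊B / δ⌋₊).subset fun k hk => ?_
  obtain ⟨b, -, hbB, hb⟩ := hx.exists_eq_coe hk.1
  refine Nat.le_floor ((le_div_iff₀ hδ).mpr ((key k b hb hbB (hb ▸ hk.2)).trans hbB))

end IsTrajectory

theorem componentAverage_apply {n p M : ℕ} {c : Fin n → Fin (M + 1)}
    (ξ : {i // c i = Fin.last M} → ℝ) (x : Fin n → ℝ → EuclideanSpace ℝ (Fin p)) (s : ℝ)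
    (l : Fin p) :
    componentAverage c (Fin.last M) ξ x s l
      = ∑ i, WeightedDigraph.extendPerron ξ i * x i s l := by
  rw [WeightedDigraph.sum_extendPerron_mul ξ fun i => x i s l]
  simp [componentAverage]

end EventTriggered

end

theorem theorem2 {n p M : ℕ} (G : EventTriggered.WeightedDigraph n) (hG : G.HasSpanningTree)
    (c : Fin n → Fin (M + 1)) (hc : G.IsPerronFrobeniusForm c)
    (ξ : {i // c i = Fin.last M} → ℝ) (hξ : G.IsPerronVector c (Fin.last M) ξ)
    (g : Fin p → ℝ → ℝ) (h : ℝ) (hg : ∀ l, EventTriggered.OutputAssumption (g l) h)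
    (α β : Fin n → ℝ) (hα : ∀ i, 0 < α i) (hβ : ∀ i, 0 < β i)
    (T : EReal) (x : Fin n → ℝ → EuclideanSpace ℝ (Fin p)) (τ : Fin n → ℕ → EReal)
    (hx : EventTriggered.IsTrajectory G g α β T x τ)
    (hne : ∃ i, x i 0 ≠ EventTriggered.componentAverage c (Fin.last M) ξ x 0) :
    EventTriggered.NoZeno T τ ∧
    (T = ⊤ →
      (∀ l, |EventTriggered.componentAverage c (Fin.last M) ξ x 0 l| < h) →
      ∀ i, Filter.Tendsto (x i) Filter.atTop
        (nhds (EventTriggered.componentAverage c (Fin.last M) ξ x 0))) := by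
  refine ⟨hx.noZeno hg hα hβ, ?_⟩
  rintro rfl hν i
  have hcoord : ∀ l, Filter.Tendsto (fun t => x i t l) Filter.atTop
      (nhds (EventTriggered.componentAverage c (Fin.last M) ξ x 0 l)) := by
    intro l
    have hl := hν l
    rw [EventTriggered.componentAverage_apply] at hl ⊢
    exact (hx.isPerturbedFlow l).tendsto_average hG hc hξ (hg l)
      (EventTriggered.hasDerivAt_errorTail hβ) (EventTriggered.errorTail_nonneg hβ)
      (EventTriggered.tendsto_errorTail hβ) hl i
  exact ((PiLp.continuous_toLp 2 _).tendsto _).comp (tendsto_pi_nhds.mpr hcoord)
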